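/- Let $H$ be a separable complex Hilbert space with an orthonormal basis $\{e_1,\dots,e_\kappa\}$, where $\kappa\le\infty$ is finite or countably infinite, and let $\mathcal A$ be a (not necessarily unital) $C^*$-algebra, represented faithfully on a Hilbert space $K$. Equip $\mathcal L(H)$ and $\mathcal L(K)$ with their weak-$*$ (that is, ultraweak) topologies, generated by the functionals $T\mapsto\operatorname{tr}(TS)$ with $S$ of trace class, and equip $\mathcal A\subseteq\mathcal L(K)$ with the restriction of the weak-$*$ topology of $\mathcal L(K)$. (If $\mathcal A$ is a $W^*$-algebra in a faithful normal representation, this is its weak-$*$ topology.) Let $\psi:\mathcal L(H)\to\mathcal A$ be a linear map which is continuous for these weak-$*$ topologies. Then $\psi$ is completely positive, meaning that for every $N$ the entrywise map $[B_{ij}]_{i,j=1}^N\mapsto[\psi(B_{ij})]_{i,j=1}^N$ sends positive elements of $\mathcal L(H)^{N\times N}$ to positive elements of $\mathcal A^{N\times N}$, if and only if the (possibly infinite) block matrix $[\psi(e_ie_j^*)]_{i,j=1}^{\kappa}$ is positive, meaning that for every finite $M\le\kappa$ its section $[\psi(e_ie_j^*)]_{i,j=1}^M$ is a positive element of the $C^*$-algebra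 $\mathcal A^{M\times M}$. Here $e_ie_j^*$ denotes the rank one operator $x\mapsto\langle x,e_j\rangle e_i$. -/

import Mathlib

/-- The weak-* topology of `L(H)` as the dual of the trace class operators (also known as the
ultraweak or σ-weak topology): the coarsest topology for which all functionals
`T ↦ ∑ₙ ⟪xₙ, T yₙ⟫` with `∑ₙ ‖xₙ‖² < ∞` and `∑ₙ ‖yₙ‖² < ∞` are continuous. These are exactly
the functionals `T ↦ trace (T S)` with `S` of trace class. -/
@[reducible]
noncomputable def weakStarTopology (H : Type*) [NormedAddCommGroup H] [InnerProductSpace ℂ H] :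
    TopologicalSpace (H →L[ℂ] H) :=
  ⨅ p : lp (fun _ : ℕ => H) 2 × lp (fun _ : ℕ => H) 2,
    TopologicalSpace.induced (fun T : H →L[ℂ] H => ∑' n, inner ℂ (p.1 n) (T (p.2 n)))
      inferInstance

/-- The series in the definition of the weak-* topology converge (absolutely). -/
theorem summable_weakStar {H : Type*} [NormedAddCommGroup H] [InnerProductSpace ℂ H]
    (x y : lp (fun _ : ℕ => H) 2) (T : H →L[ℂ] H) :
    Summable (fun n => inner ℂ (x n) (T (y n))) := by
  have hx := (lp.memℓp x).summable (by norm_num)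
  have hy := (lp.memℓp y).summable (by norm_num)
  refine Summable.of_norm_bounded ((hx.add hy).mul_left ‖T‖) fun n => ?_
  have h1 := norm_inner_le_norm (𝕜 := ℂ) (x n) (T (y n))
  have h2 := T.le_opNorm (y n)
  have h3 : ‖x n‖ * ‖T (y n)‖ ≤ ‖x n‖ * (‖T‖ * ‖y n‖) :=
    mul_le_mul_of_nonneg_left h2 (norm_nonneg _)
  have h4 : ‖x n‖ * ‖y n‖ ≤ ‖x n‖ ^ 2 + ‖y n‖ ^ 2 := by
    nlinarith [sq_nonneg (‖x n‖ - ‖y n‖), sq_nonneg ‖x n‖, sq_nonneg ‖y n‖]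
  have h5 := mul_le_mul_of_nonneg_left h4 (norm_nonneg T)
  simp only [ENNReal.toReal_ofNat, Real.rpow_ofNat]
  nlinarith

/-- The weak-* topology on a C⋆-algebra `A` realised on a Hilbert space `K` by the
representation `π`: the weak-* topology of `L(K)` restricted to `A`. -/
@[reducible]
noncomputable def weakStarTopologyOn {A K : Type*} [NonUnitalCStarAlgebra A] [NormedAddCommGroup K]
    [InnerProductSpace ℂ K] [CompleteSpace K] (π : A →⋆ₙₐ[ℂ] (K →L[ℂ] K)) :
    TopologicalSpace A :=
  TopologicalSpace.induced π (weakStarTopology K)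

/-- A linear map between C⋆-algebras is completely positive if it underlies one of Mathlib's
bundled completely positive maps, that is, if applying it entrywise sends positive `k × k`
matrices to positive `k × k` matrices, for every `k`. -/
def IsCompletelyPositive {A B : Type*} [NonUnitalCStarAlgebra A] [PartialOrder A]
    [StarOrderedRing A] [NonUnitalCStarAlgebra B] [PartialOrder B] [StarOrderedRing B]
    (ψ : A →ₗ[ℂ] B) : Prop :=
  ∃ φ : CompletelyPositiveMap A B, φ.toLinearMap = ψ

/-- The `M × M` section `[ψ(eᵢ eⱼ*)]`, `0 ≤ i, j < M`, of the block matrix of `ψ` with respect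
to an orthonormal basis `e₀, e₁, …` of length `κ ≤ ∞`, as an element of the C⋆-algebra of
`M × M` matrices over `A`. -/
noncomputable def choiSection {H A : Type*} [NormedAddCommGroup H] [InnerProductSpace ℂ H]
    [NonUnitalCStarAlgebra A] {κ : ℕ∞}
    (e : HilbertBasis {n : ℕ // (n : ℕ∞) < κ} ℂ H) (ψ : (H →L[ℂ] H) →ₗ[ℂ] A)
    (M : ℕ) (hM : (M : ℕ∞) ≤ κ) : CStarMatrix (Fin M) (Fin M) A :=
  CStarMatrix.ofMatrix fun i j =>
    ψ (InnerProductSpace.rankOne ℂ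
      (e ⟨i, lt_of_lt_of_le (Nat.cast_lt.mpr i.isLt) hM⟩)
      (e ⟨j, lt_of_lt_of_le (Nat.cast_lt.mpr j.isLt) hM⟩))

/-- The block matrix `[ψ(eᵢ eⱼ*)]` is positive: every finite section is positive. If `κ` is
finite, the section with `M = κ` is the whole matrix, and the others are corners of it. -/
def IsPositiveChoiMatrix {H A : Type*} [NormedAddCommGroup H] [InnerProductSpace ℂ H]
    [NonUnitalCStarAlgebra A] [PartialOrder A] [StarOrderedRing A] {κ : ℕ∞}
    (e : HilbertBasis {n : ℕ // (n : ℕ∞) < κ} ℂ H) (ψ : (H →L[ℂ] H) →ₗ[ℂ] A) : Prop :=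
  ∀ (M : ℕ) (hM : (M : ℕ∞) ≤ κ), 0 ≤ choiSection e ψ M hM

/-! The matrix $[e_ie_j^*]$ is itself positive, so complete positivity forces a positive block
matrix. Conversely, let $[X_{ij}]\ge 0$ and replace each $X_{ij}$ by its compression to the span of
finitely many $e_a$. By linearity, $\psi$ sends the compression to
$\sum_{a,b}\beta_{(i,a),(j,b)}\,\psi(e_ae_b^*)$ with $\beta_{(i,a),(j,b)}=\langle
e_a,X_{ij}e_b\rangle$, a positive semidefinite scalar matrix. Factoring $\beta=\gamma^*\gamma$ turns
the quadratic form of the result into a sum of values of the form of the block matrix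
(`Matrix.PosSemidef.sum_mul_inner_nonneg`). Compressions converge weak-*
(`HilbertBasis.tendsto_compress`), so positivity passes to the limit by continuity of $\psi$. The
faithful representation allows positivity over $A$ to be tested by quadratic forms throughout
(`cstarMatrix_nonneg_iff_sum_inner`). -/

/-- An injective ⋆-homomorphism of C⋆-algebras reflects positivity. -/
theorem NonUnitalStarAlgHom.nonneg_of_map_nonneg {A B : Type*}
    [NonUnitalCStarAlgebra A] [PartialOrder A] [StarOrderedRing A]
    [NonUnitalCStarAlgebra B] [PartialOrder B] [StarOrderedRing B]
    (π : A →⋆ₙₐ[ℂ] B) (hπ : Function.Injective π) {a : A} (h : 0 ≤ π a) : 0 ≤ a := by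
  have ha : IsSelfAdjoint a := hπ (by rw [map_star]; exact (IsSelfAdjoint.of_nonneg h))
  -- `π` commutes with the functional calculus, so it carries the negative part of `a` to that of `π
  -- a`, which vanishes.
  have hneg : π (a⁻) = (π a)⁻ := by
    rw [CFC.negPart_def, CFC.negPart_def]
    exact NonUnitalStarAlgHomClass.map_cfcₙ π _ a
  rw [(CFC.negPart_eq_zero_iff (π a)).2 h] at hneg
  exact (CFC.negPart_eq_zero_iff a).1 (hπ (by rw [hneg, map_zero]))

/-- The action of matrices over `A` on `Kⁿ` induced by a representation of `A` on `K`. -/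
noncomputable def matrixRep {A K n : Type*} [Fintype n] [NonUnitalCStarAlgebra A]
    [NormedAddCommGroup K] [InnerProductSpace ℂ K] [CompleteSpace K] (π : A →⋆ₙₐ[ℂ] (K →L[ℂ] K)) :
    CStarMatrix n n A →⋆ₙₐ[ℂ]
      (PiLp 2 (fun _ : n => K) →L[ℂ] PiLp 2 (fun _ : n => K)) where
  toFun X := (PiLp.continuousLinearEquiv 2 ℂ (fun _ : n => K)).symm.toContinuousLinearMap ∘L
    ContinuousLinearMap.pi fun i => ∑ j, π (X i j) ∘L PiLp.proj 2 (fun _ : n => K) j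
  map_smul' c X := by
    ext v i
    simp [Finset.smul_sum]
  map_zero' := by
    ext v i
    simp
  map_add' X Y := by
    ext v i
    simp [Finset.sum_add_distrib]
  map_mul' X Y := by
    ext v i
    simp only [CStarMatrix.mul_apply, map_sum, map_mul, ContinuousLinearMap.comp_apply,
      mul_apply_eq_comp, _root_.sum_apply, ContinuousLinearMap.pi_apply,
      ContinuousLinearEquiv.coe_coe, PiLp.proj_apply, PiLp.continuousLinearEquiv_symm_apply]
    exact Finset.sum_comm
  map_star' X := by
    rw [ContinuousLinearMap.star_eq_adjoint]
    refine (ContinuousLinearMap.eq_adjoint_iff _ _).2 fun v w => ?_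
    simp only [PiLp.inner_apply, ContinuousLinearMap.comp_apply,
      _root_.sum_apply, ContinuousLinearMap.pi_apply,
      ContinuousLinearEquiv.coe_coe, PiLp.proj_apply, PiLp.continuousLinearEquiv_symm_apply,
      sum_inner, inner_sum, CStarMatrix.star_apply, map_star,
      ContinuousLinearMap.star_eq_adjoint, ContinuousLinearMap.adjoint_inner_left]
    exact Finset.sum_comm

theorem matrixRep_apply_apply {A K n : Type*} [Fintype n] [NonUnitalCStarAlgebra A]
    [NormedAddCommGroup K] [InnerProductSpace ℂ K] [CompleteSpace K] (π : A →⋆ₙₐ[ℂ] (K →L[ℂ] K))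
    (X : CStarMatrix n n A) (v : PiLp 2 (fun _ : n => K)) (i : n) :
    matrixRep π X v i = ∑ j, π (X i j) (v j) := by
  simp [matrixRep]

theorem matrixRep_injective {A K n : Type*} [Fintype n] [NonUnitalCStarAlgebra A]
    [NormedAddCommGroup K] [InnerProductSpace ℂ K] [CompleteSpace K] {π : A →⋆ₙₐ[ℂ] (K →L[ℂ] K)}
    (hπ : Function.Injective π) : Function.Injective (matrixRep (n := n) π) := by
  classical
  refine (injective_iff_map_eq_zero _).2 fun X hX => CStarMatrix.ext fun i j => hπ ?_
  ext v
  have h := congrArg (fun T => T (PiLp.single 2 j v) i) hX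
  simpa [matrixRep_apply_apply, Pi.single_apply, apply_ite] using h

open scoped ComplexOrder in
/-- A matrix over a faithfully represented C⋆-algebra is positive iff its quadratic form is. -/
theorem cstarMatrix_nonneg_iff_sum_inner {A K n : Type*} [Fintype n] [NonUnitalCStarAlgebra A]
    [PartialOrder A] [StarOrderedRing A]
    [NormedAddCommGroup K] [InnerProductSpace ℂ K] [CompleteSpace K] {π : A →⋆ₙₐ[ℂ] (K →L[ℂ] K)}
    (hπ : Function.Injective π) (X : CStarMatrix n n A) :
    0 ≤ X ↔ ∀ v : n → K, 0 ≤ ∑ i, ∑ j, inner ℂ (v i) (π (X i j) (v j)) := by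
  have key (v : PiLp 2 (fun _ : n => K)) : inner ℂ v (matrixRep π X v) =
      ∑ i, ∑ j, inner ℂ (v i) (π (X i j) (v j)) := by
    simp only [PiLp.inner_apply, matrixRep_apply_apply, inner_sum]
  have h : 0 ≤ X ↔ 0 ≤ matrixRep π X :=
    ⟨fun h => map_nonneg _ h,
      fun h => NonUnitalStarAlgHom.nonneg_of_map_nonneg _ (matrixRep_injective hπ) h⟩
  rw [h, ContinuousLinearMap.nonneg_iff_isPositive, ContinuousLinearMap.isPositive_iff_complex]
  have aux (v : PiLp 2 (fun _ : n => K)) :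
      (((inner ℂ (matrixRep π X v) v).re : ℂ) = inner ℂ (matrixRep π X v) v ∧
        0 ≤ (inner ℂ (matrixRep π X v) v).re) ↔
      0 ≤ ∑ i, ∑ j, inner ℂ (v i) (π (X i j) (v j)) := by
    rw [← inner_conj_symm, key, Complex.nonneg_iff, Complex.conj_re]
    generalize ∑ i, ∑ j, inner ℂ (v i) (π (X i j) (v j)) = z
    exact ⟨fun ⟨h, h'⟩ => ⟨h', .symm (by simpa using congrArg Complex.im h)⟩,
      fun ⟨h', h⟩ => ⟨Complex.ext (by simp) (by simp [← h]), h'⟩⟩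
  exact ⟨fun h v => (aux (WithLp.toLp 2 v)).1 (h _), fun h v => (aux v).2 (h v)⟩

/-! ### Weak-* approximation by finite-rank compressions -/

/-- The truncation of a vector to the span of finitely many vectors of a Hilbert basis. -/
noncomputable def HilbertBasis.truncate {ι H : Type*} [NormedAddCommGroup H] [InnerProductSpace ℂ H]
    (e : HilbertBasis ι ℂ H) (s : Finset ι) (x : H) : H := ∑ a ∈ s, inner ℂ (e a) x • e a

/-- This is Bessel's inequality; it supplies the domination, uniform in `s`, in
`HilbertBasis.tendsto_compress`. -/
theorem HilbertBasis.norm_truncate_le {ι H : Type*} [NormedAddCommGroup H] [InnerProductSpace ℂ H]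
    (e : HilbertBasis ι ℂ H) (s : Finset ι) (x : H) : ‖e.truncate s x‖ ≤ ‖x‖ := by
  refine (sq_le_sq₀ (norm_nonneg _) (norm_nonneg _)).1 ?_
  refine le_trans (le_of_eq ?_) (e.orthonormal.sum_inner_products_le x (s := s))
  rw [← Complex.ofReal_inj, Complex.ofReal_pow]
  refine (inner_self_eq_norm_sq_to_K (𝕜 := ℂ) (e.truncate s x)).symm.trans ?_
  rw [HilbertBasis.truncate, e.orthonormal.inner_sum]
  simp only [Complex.conj_mul', Complex.ofReal_sum, Complex.ofReal_pow]

theorem HilbertBasis.tendsto_truncate {ι H : Type*} [NormedAddCommGroup H] [InnerProductSpace ℂ H]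
    (e : HilbertBasis ι ℂ H) (x : H) :
    Filter.Tendsto (fun s => e.truncate s x) Filter.atTop (nhds x) := by
  simpa only [HasSum, SummationFilter.unconditional_filter, HilbertBasis.repr_apply_apply] using!
    e.hasSum_repr x

/-- The compression of an operator to the span of finitely many vectors of a Hilbert basis. -/
noncomputable def HilbertBasis.compress {ι H : Type*} [NormedAddCommGroup H]
    [InnerProductSpace ℂ H] (e : HilbertBasis ι ℂ H) (s : Finset ι) (T : H →L[ℂ] H) :
    H →L[ℂ] H :=
  ∑ a ∈ s, ∑ b ∈ s, inner ℂ (e a) (T (e b)) • InnerProductSpace.rankOne ℂ (e a) (e b)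

/-- The compression is $P_sTP_s$, with $P_s$ the self-adjoint truncation. -/
theorem HilbertBasis.inner_compress {ι H : Type*} [NormedAddCommGroup H]
    [InnerProductSpace ℂ H] (e : HilbertBasis ι ℂ H) (s : Finset ι) (T : H →L[ℂ] H) (x y : H) :
    inner ℂ x (e.compress s T y) = inner ℂ (e.truncate s x) (T (e.truncate s y)) := by
  simp only [HilbertBasis.compress, HilbertBasis.truncate, _root_.sum_apply,
    _root_.smul_apply, InnerProductSpace.rankOne_apply, map_sum, map_smul,
    sum_inner, inner_sum, inner_smul_left, inner_smul_right, inner_conj_symm]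
  rw [Finset.sum_comm]
  refine Finset.sum_congr rfl fun a _ => ?_
  rw [Finset.mul_sum]
  refine Finset.sum_congr rfl fun b _ => ?_
  ring

theorem HilbertBasis.tendsto_compress {ι H : Type*} [NormedAddCommGroup H]
    [InnerProductSpace ℂ H] (e : HilbertBasis ι ℂ H) (T : H →L[ℂ] H) :
    Filter.Tendsto (fun s => e.compress s T) Filter.atTop
      (@nhds (H →L[ℂ] H) (weakStarTopology H) T) := by
  rw [nhds_iInf, Filter.tendsto_iInf]
  rintro ⟨x, y⟩
  rw [nhds_induced, Filter.tendsto_comap_iff]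
  have hx := (lp.memℓp x).summable (by norm_num)
  have hy := (lp.memℓp y).summable (by norm_num)
  simp only [ENNReal.toReal_ofNat, Real.rpow_ofNat] at hx hy
  -- Each term converges because truncations converge in norm; the bound is independent of `s` and
  -- summable because `x` and `y` are square summable.
  refine tendsto_tsum_of_dominated_convergence
    (bound := fun n => ‖T‖ * (‖x n‖ ^ 2 + ‖y n‖ ^ 2)) ((hx.add hy).mul_left _)
    (fun n => ?_) (Filter.Eventually.of_forall fun s n => ?_)
  · simp only [HilbertBasis.inner_compress]
    exact (e.tendsto_truncate _).inner
      ((T.continuous.tendsto _).comp (e.tendsto_truncate _))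
  · rw [HilbertBasis.inner_compress]
    calc _ ≤ ‖e.truncate s (x n)‖ * ‖T (e.truncate s (y n))‖ := norm_inner_le_norm _ _
      _ ≤ ‖x n‖ * (‖T‖ * ‖y n‖) := by
        gcongr
        · exact e.norm_truncate_le _ _
        · exact (T.le_opNorm _).trans (by gcongr; exact e.norm_truncate_le _ _)
      _ ≤ _ := by
        have : ‖x n‖ * ‖y n‖ ≤ ‖x n‖ ^ 2 + ‖y n‖ ^ 2 := by
          nlinarith [sq_nonneg (‖x n‖ - ‖y n‖), sq_nonneg ‖x n‖, sq_nonneg ‖y n‖]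
        nlinarith [mul_le_mul_of_nonneg_left this (norm_nonneg T)]

/-- The functional belongs to the defining family: take both sequences concentrated at index 0. -/
theorem continuous_weakStar_inner {K : Type*} [NormedAddCommGroup K] [InnerProductSpace ℂ K]
    (x y : K) :
    @Continuous (K →L[ℂ] K) ℂ (weakStarTopology K) _ (fun T => inner ℂ x (T y)) := by
  have h : @Continuous (K →L[ℂ] K) ℂ (weakStarTopology K) _ (fun T => ∑' n,
      inner ℂ ((lp.single 2 0 x : lp (fun _ : ℕ => K) 2) n)
        (T ((lp.single 2 0 y : lp (fun _ : ℕ => K) 2) n))) :=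
    continuous_iInf_dom (i := (lp.single 2 0 x, lp.single 2 0 y)) continuous_induced_dom
  convert h using 2 with T
  rw [tsum_eq_single 0 fun n hn => by simp [hn]]
  simp

/-! ### Positive forms and their contractions -/

open scoped ComplexOrder in
/-- A positive semidefinite scalar matrix contracts with a positive operator-valued form to a
positive form. -/
theorem Matrix.PosSemidef.sum_mul_inner_nonneg {n m K : Type*} [Fintype n] [Fintype m]
    [NormedAddCommGroup K] [InnerProductSpace ℂ K] {β : Matrix (n × m) (n × m) ℂ}
    (hβ : β.PosSemidef) {T : m → m → K →L[ℂ] K}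
    (hT : ∀ v : m → K, 0 ≤ ∑ a, ∑ b, inner ℂ (v a) (T a b (v b))) (v : n → K) :
    0 ≤ ∑ i, ∑ j, ∑ a, ∑ b, β (i, a) (j, b) * inner ℂ (v i) (T a b (v j)) := by
  classical
  open scoped MatrixOrder Matrix.Norms.L2Operator in
  obtain ⟨γ, rfl⟩ := CStarAlgebra.nonneg_iff_eq_star_mul_self.mp hβ.nonneg
  -- With $\beta=\gamma^*\gamma$, row `k` of `γ` contributes the form of `T` at the vectors
  -- $\sum_i\gamma_{k,(i,a)}v_i$.
  have h := Finset.sum_nonneg fun k (_ : k ∈ Finset.univ) =>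
    hT fun a => ∑ i, γ k (i, a) • v i
  refine h.trans_eq ?_
  simp only [sum_inner, inner_sum, map_sum, map_smul, inner_smul_left, inner_smul_right,
    Matrix.mul_apply, Matrix.star_apply, Finset.sum_mul]
  calc _ = ∑ k, ∑ i, ∑ j, ∑ a, ∑ b, star (γ k (i, a)) * γ k (j, b) *
        inner ℂ (v i) (T a b (v j)) := by
        refine Finset.sum_congr rfl fun k _ => ?_
        simp only [Finset.mul_sum]
        rw [Finset.sum_congr rfl fun a _ => Finset.sum_comm, Finset.sum_comm,
          Finset.sum_congr rfl fun j _ => Finset.sum_congr rfl fun a _ => Finset.sum_comm,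
          Finset.sum_congr rfl fun j _ => Finset.sum_comm, Finset.sum_comm]
        refine Finset.sum_congr rfl fun i _ => Finset.sum_congr rfl fun j _ =>
          Finset.sum_congr rfl fun a _ => Finset.sum_congr rfl fun b _ => ?_
        rw [starRingEnd_apply]
        ring
    _ = _ := by
      rw [Finset.sum_comm]
      refine Finset.sum_congr rfl fun i _ => ?_
      rw [Finset.sum_comm]
      refine Finset.sum_congr rfl fun j _ => ?_
      rw [Finset.sum_comm]
      refine Finset.sum_congr rfl fun a _ => ?_
      rw [Finset.sum_comm]

open scoped ComplexOrder in
/-- Positivity of an operator-valued form is preserved by pulling back its indices. -/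
theorem sum_inner_comp_nonneg {ι m K : Type*} [Fintype ι] [Fintype m]
    [NormedAddCommGroup K] [InnerProductSpace ℂ K] {T : ι → ι → K →L[ℂ] K}
    (hT : ∀ v : ι → K, 0 ≤ ∑ i, ∑ j, inner ℂ (v i) (T i j (v j))) (g : m → ι) (w : m → K) :
    0 ≤ ∑ a, ∑ b, inner ℂ (w a) (T (g a) (g b) (w b)) := by
  classical
  have key (f : ι → m → ℂ) : ∑ i, ∑ a with g a = i, f i a = ∑ a, f (g a) a := by
    simp only [Finset.sum_filter]
    rw [Finset.sum_comm]
    simp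
  -- Evaluate the form at the sums of `w` over the fibres of `g`, which need not be injective.
  refine (hT fun i => ∑ a with g a = i, w a).trans_eq ?_
  simp only [sum_inner, map_sum, inner_sum, key]
  rw [Finset.sum_comm, Finset.sum_congr rfl fun b _ => key _, Finset.sum_comm]

-- The scalar form at `x` is the quadratic form of `X` at the vectors $\sum_a x_{(i,a)}e_a$.
open scoped ComplexOrder in
theorem posSemidef_inner_of_nonneg {n m H : Type*} [Fintype n] [Fintype m]
    [NormedAddCommGroup H] [InnerProductSpace ℂ H] [CompleteSpace H]
    {X : CStarMatrix n n (H →L[ℂ] H)} (hX : 0 ≤ X) (e : m → H) :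
    (Matrix.of fun p q : n × m => inner ℂ (e p.2) (X p.1 q.1 (e q.2))).PosSemidef := by
  have hform := (cstarMatrix_nonneg_iff_sum_inner
    (π := NonUnitalStarAlgHom.id ℂ (H →L[ℂ] H)) Function.injective_id X).1 hX
  refine Matrix.PosSemidef.of_dotProduct_mulVec_nonneg ?_ fun x => ?_
  · refine Matrix.IsHermitian.ext fun p q => ?_
    have h : star (X q.1 p.1) = X p.1 q.1 :=
      CStarMatrix.ext_iff.2 (IsSelfAdjoint.of_nonneg hX).star_eq p.1 q.1
    simp only [Matrix.of_apply, ← h, ContinuousLinearMap.star_eq_adjoint,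
      ContinuousLinearMap.adjoint_inner_right]
    exact inner_conj_symm _ _
  · refine (hform fun i => ∑ a, x (i, a) • e a).trans_eq ?_
    simp only [NonUnitalStarAlgHom.coe_id, id, sum_inner, inner_sum, map_sum, map_smul,
      inner_smul_left, inner_smul_right, dotProduct, Matrix.mulVec, Fintype.sum_prod_type,
      Matrix.of_apply, Finset.mul_sum, Pi.star_apply]
    refine Finset.sum_congr rfl fun i _ => ?_
    conv_rhs => rw [Finset.sum_comm]
    refine Finset.sum_congr rfl fun j _ => ?_
    rw [Finset.sum_comm]
    refine Finset.sum_congr rfl fun a _ => Finset.sum_congr rfl fun b _ => ?_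
    rw [starRingEnd_apply]
    ring

-- The quadratic form at `v` is $|\sum_i\langle e_i,v_i\rangle|^2$.
open scoped ComplexOrder in
theorem nonneg_ofMatrix_rankOne {n H : Type*} [Fintype n]
    [NormedAddCommGroup H] [InnerProductSpace ℂ H] [CompleteSpace H] (e : n → H) :
    0 ≤ CStarMatrix.ofMatrix fun i j => InnerProductSpace.rankOne ℂ (e i) (e j) := by
  refine (cstarMatrix_nonneg_iff_sum_inner
    (π := NonUnitalStarAlgHom.id ℂ (H →L[ℂ] H)) Function.injective_id _).2 fun v => ?_
  refine (star_mul_self_nonneg (∑ i, inner ℂ (e i) (v i))).trans_eq ?_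
  simp only [star_sum, Finset.sum_mul_sum]
  refine Finset.sum_congr rfl fun i _ => Finset.sum_congr rfl fun j _ => ?_
  change _ = inner ℂ (v i) (InnerProductSpace.rankOne ℂ (e i) (e j) (v j))
  rw [InnerProductSpace.rankOne_apply, inner_smul_right, mul_comm, ← inner_conj_symm (v i)]
  rfl

-- Passes from initial sections to arbitrary finite index sets, as needed for limits along finite
-- subsets of the basis.
open scoped ComplexOrder in
theorem IsPositiveChoiMatrix.sum_inner_nonneg {H A K : Type*}
    [NormedAddCommGroup H] [InnerProductSpace ℂ H]
    [NonUnitalCStarAlgebra A] [PartialOrder A] [StarOrderedRing A]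
    [NormedAddCommGroup K] [InnerProductSpace ℂ K] [CompleteSpace K]
    {π : A →⋆ₙₐ[ℂ] (K →L[ℂ] K)} (hπ : Function.Injective π)
    {κ : ℕ∞} {e : HilbertBasis {n : ℕ // (n : ℕ∞) < κ} ℂ H}
    {ψ : (H →L[ℂ] H) →ₗ[ℂ] A} (h : IsPositiveChoiMatrix e ψ)
    (s : Finset {n : ℕ // (n : ℕ∞) < κ}) (w : s → K) :
    0 ≤ ∑ a : s, ∑ b : s, inner ℂ (w a) (π (ψ (InnerProductSpace.rankOne ℂ (e a) (e b))) (w b)) := by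
  -- The least `M` exceeding every index in `s`; it is 0 when `s` is empty.
  have hM : ((s.sup fun a => (a : ℕ) + 1 : ℕ) : ℕ∞) ≤ κ :=
    Finset.sup_induction (p := fun k : ℕ => (k : ℕ∞) ≤ κ) (by simp)
      (fun a ha b hb => by rcases max_choice a b with h | h <;> simpa [h])
      (fun a _ => by simpa using Order.add_one_le_of_lt a.2)
  exact sum_inner_comp_nonneg ((cstarMatrix_nonneg_iff_sum_inner hπ _).1 (h _ hM))
    (fun a : s => ⟨a.1.1, Nat.lt_of_succ_le (Finset.le_sup (f := fun a => (a.1 : ℕ) + 1) a.2)⟩) w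

/-! ### The two implications -/

/-- The block matrix of a completely positive map is positive. -/
theorem IsCompletelyPositive.isPositiveChoiMatrix {H A : Type*}
    [NormedAddCommGroup H] [InnerProductSpace ℂ H] [CompleteSpace H]
    [NonUnitalCStarAlgebra A] [PartialOrder A] [StarOrderedRing A]
    {κ : ℕ∞} (e : HilbertBasis {n : ℕ // (n : ℕ∞) < κ} ℂ H)
    {ψ : (H →L[ℂ] H) →ₗ[ℂ] A} (h : IsCompletelyPositive ψ) : IsPositiveChoiMatrix e ψ := by
  obtain ⟨φ, rfl⟩ := h
  exact fun M _ => φ.map_cstarMatrix_nonneg' M _ (nonneg_ofMatrix_rankOne _)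

open scoped ComplexOrder in
/-- A weak-* continuous map with positive block matrix is completely positive. -/
theorem IsPositiveChoiMatrix.isCompletelyPositive {H A K : Type*}
    [NormedAddCommGroup H] [InnerProductSpace ℂ H] [CompleteSpace H]
    [NonUnitalCStarAlgebra A] [PartialOrder A] [StarOrderedRing A]
    [NormedAddCommGroup K] [InnerProductSpace ℂ K] [CompleteSpace K]
    {π : A →⋆ₙₐ[ℂ] (K →L[ℂ] K)} (hπ : Function.Injective π)
    {κ : ℕ∞} {e : HilbertBasis {n : ℕ // (n : ℕ∞) < κ} ℂ H}
    {ψ : (H →L[ℂ] H) →ₗ[ℂ] A}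
    (hψ : @Continuous (H →L[ℂ] H) A (weakStarTopology H) (weakStarTopologyOn π) ψ)
    (h : IsPositiveChoiMatrix e ψ) :
    IsCompletelyPositive ψ := by
  refine ⟨⟨ψ, fun N X hX => (cstarMatrix_nonneg_iff_sum_inner hπ _).2 fun v => ?_⟩, rfl⟩
  have hcont (x y : K) : @Continuous (H →L[ℂ] H) ℂ (weakStarTopology H) _
      (fun T => inner ℂ x (π (ψ T) y)) :=
    @Continuous.comp _ _ _ (weakStarTopology H) (weakStarTopologyOn π) _ _ _
      (@Continuous.comp _ _ _ (weakStarTopologyOn π) (weakStarTopology K) _ _ _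
        (continuous_weakStar_inner x y) continuous_induced_dom) hψ
  have hlim : Filter.Tendsto
      (fun s => ∑ i, ∑ j, inner ℂ (v i) (π (ψ (e.compress s (X i j))) (v j)))
      Filter.atTop (nhds (∑ i, ∑ j, inner ℂ (v i) (π (ψ (X i j)) (v j)))) :=
    tendsto_finsetSum _ fun i _ => tendsto_finsetSum _ fun j _ =>
      (@Continuous.tendsto _ _ (weakStarTopology H) _ _ (hcont (v i) (v j)) _).comp
        (e.tendsto_compress (X i j))
  -- It suffices to treat the compressions, where `ψ` only meets the operators $e_ae_b^*$ with `a`,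
  -- `b` in `s`.
  refine ge_of_tendsto' hlim fun s => ?_
  refine ((posSemidef_inner_of_nonneg hX fun a : s => e a).sum_mul_inner_nonneg
    (IsPositiveChoiMatrix.sum_inner_nonneg hπ h s) v).trans_eq ?_
  refine Finset.sum_congr rfl fun i _ => Finset.sum_congr rfl fun j _ => ?_
  simp only [HilbertBasis.compress, ← Finset.sum_coe_sort s, map_sum, map_smul,
    _root_.sum_apply, _root_.smul_apply, inner_sum, inner_smul_right, Matrix.of_apply]

theorem theoremT {H A K : Type*}
    [NormedAddCommGroup H] [InnerProductSpace ℂ H] [CompleteSpace H]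
    [NonUnitalCStarAlgebra A] [PartialOrder A] [StarOrderedRing A]
    [NormedAddCommGroup K] [InnerProductSpace ℂ K] [CompleteSpace K]
    (π : A →⋆ₙₐ[ℂ] (K →L[ℂ] K)) (hπ : Function.Injective π)
    {κ : ℕ∞} (e : HilbertBasis {n : ℕ // (n : ℕ∞) < κ} ℂ H)
    (ψ : (H →L[ℂ] H) →ₗ[ℂ] A)
    (hψ : @Continuous (H →L[ℂ] H) A (weakStarTopology H) (weakStarTopologyOn π) ψ) :
    IsCompletelyPositive ψ ↔ IsPositiveChoiMatrix e ψ :=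
  ⟨fun h => h.isPositiveChoiMatrix e, fun h => h.isCompletelyPositive hπ hψ⟩
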